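/- Let $d \ge 3$ be an odd integer, let $X = \{1, \dots, d\}$, and let $T$ be the $d$-regular rooted tree whose vertices are the words over $X$, the root being the empty word and the children of a word $u$ being the words $ux$ with $x \in X$. Let $\mathrm{Aut}(T)$ be the group of root-preserving graph automorphisms of $T$, with product $(gh)(u) = h(g(u))$. Let $a_1, \dots, a_d \in \mathrm{Aut}(T)$ be defined recursively as follows, with indices and letters read modulo $d$: $a_i$ fixes the empty word, and for every word $v$, $$a_i(iv) = (i+1)\,a_i(v), \qquad a_i((i+1)v) = i\,a_{i+1}(v), \qquad a_i(xv) = xv \quad (x \in X \setminus \{i, i+1\}).$$ In wreath recursion notation, $a_i$ acts on $X$ as the transposition $(i\;\, i+1)$ and has sections $a_i$ at $i$, $a_{i+1}$ at $i+1$, and $e$ at all other letters. Let $G_d = \langle a_1, \dots, a_d \rangle \le \mathrm{Aut}(T)$. Then the subsemigroup of $G_d$ generated by $a_1$ and $a_2$ is free on $a_1, a_2$, and $G_d$ has exponential word growth: $G_d$ is finitely generated, and for every finite generating set $S$ of $G_d$ there is a real number $c > 1$ such that, for all integers $n \ge 0$, at least $c^n$ elements of $G_d$ are represented by words of length at most $n$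 over $S \cup S^{-1}$. -/

import Mathlib

/-! ### Word growth and free subsemigroups -/

/-- The ball of radius `n` in the word metric: the elements of `G` that are represented by a word
of length at most `n` over `S ∪ S⁻¹`. -/
def wordBall {G : Type*} [Group G] (S : Set G) (n : ℕ) : Set G :=
  {g | ∃ w : List G, w.length ≤ n ∧ (∀ s ∈ w, s ∈ S ∨ s⁻¹ ∈ S) ∧ w.prod = g}

/-- The word growth function of `G` with respect to `S`. -/
noncomputable def growthFunction {G : Type*} [Group G] (S : Set G) (n : ℕ) : ℕ :=
  (wordBall S n).ncard

/-- A group has exponential word growth if it is finitely generated and, for every finite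
generating set, its growth function is bounded below by `c ^ n` for some `c > 1`. -/
def HasExponentialGrowth (G : Type*) [Group G] : Prop :=
  Group.FG G ∧ ∀ S : Set G, S.Finite → Subgroup.closure S = ⊤ →
    ∃ c : ℝ, 1 < c ∧ ∀ n : ℕ, c ^ n ≤ (growthFunction S n : ℝ)

/-- The family `f` freely generates a subsemigroup: the canonical homomorphism from the free
semigroup on the index set onto the subsemigroup generated by the family is an isomorphism. -/
def FreelyGeneratesSubsemigroup {M ι : Type*} [Semigroup M] (f : ι → M) : Prop :=
  Function.Bijective
    (FreeSemigroup.lift fun i : ι =>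
      (⟨f i, Subsemigroup.subset_closure (Set.mem_range_self i)⟩ :
        Subsemigroup.closure (Set.range f)))

/-! ### The regular rooted tree and its automorphism group -/

/-- The `d`-regular rooted tree. Its vertices are the words over the alphabet
`X = {1, …, d}`, a letter being identified with its residue class modulo `d`; every word `u` is
joined to its `d` children `ux`. -/
def regularTree (d : ℕ) : SimpleGraph (List (ZMod d)) where
  Adj u v := (∃ x, v = u ++ [x]) ∨ (∃ x, u = v ++ [x])
  symm := ⟨fun _ _ h => h.symm⟩
  loopless := ⟨fun u h => by
    rcases h with ⟨x, hx⟩ | ⟨x, hx⟩ <;> simpa using congrArg List.length hx⟩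

/-- The graph automorphisms of the tree that fix the root, with the usual composition of maps. -/
def rootFixing (d : ℕ) : Subgroup (regularTree d ≃g regularTree d) where
  carrier := {g | g [] = []}
  one_mem' := rfl
  mul_mem' := fun {g h} hg hh => by
    change g (h []) = []
    rw [show h [] = [] from hh]
    exact hg
  inv_mem' := fun {g} hg => by
    change g.symm [] = []
    rw [RelIso.symm_apply_eq]
    exact (show g [] = [] from hg).symm

/-- `Aut(T)`, with maps composed from left to right: `(g h)(u) = h(g(u))`. This is the opposite of
the usual composition. -/
abbrev AutTree (d : ℕ) : Type := (rootFixing d)ᵐᵒᵖ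

/-- The action of `g ∈ Aut(T)` on the vertices. -/
def AutTree.act {d : ℕ} (g : AutTree d) (u : List (ZMod d)) : List (ZMod d) :=
  (g.unop : regularTree d ≃g regularTree d) u

theorem AutTree.mul_act {d : ℕ} (g h : AutTree d) (u : List (ZMod d)) :
    (g * h).act u = h.act (g.act u) := rfl

/-! ### The generators -/

/-- The action of `a i` on words, from the wreath recursion
`a i = (e, …, e, a i, a (i + 1), e, …, e) (i  i+1)`, the nontrivial sections being at the letters
`i` and `i + 1`; all indices are modulo `d`. -/
def genFun {d : ℕ} : ZMod d → List (ZMod d) → List (ZMod d)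
  | _, [] => []
  | i, x :: v =>
      Equiv.swap i (i + 1) x ::
        (if x = i then genFun i v else if x = i + 1 then genFun (i + 1) v else v)

/-- The inverse map of `genFun i`. -/
def genInv {d : ℕ} : ZMod d → List (ZMod d) → List (ZMod d)
  | _, [] => []
  | i, y :: v =>
      Equiv.swap i (i + 1) y ::
        (if y = i + 1 then genInv i v else if y = i then genInv (i + 1) v else v)

theorem genInv_genFun {d : ℕ} (v : List (ZMod d)) (i : ZMod d) : genInv i (genFun i v) = v := by
  induction v generalizing i with
  | nil => rfl
  | cons x v ih =>
    simp only [genFun, genInv, Equiv.swap_apply_self, List.cons.injEq, true_and]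
    by_cases h1 : x = i
    · subst h1; simp [ih]
    · by_cases h2 : x = i + 1
      · subst h2
        have h3 : i ≠ i + 1 := fun h => h1 h.symm
        simp [ih, h1, h3]
      · rw [Equiv.swap_apply_of_ne_of_ne h1 h2]; simp [h1, h2]

theorem genFun_genInv {d : ℕ} (v : List (ZMod d)) (i : ZMod d) : genFun i (genInv i v) = v := by
  induction v generalizing i with
  | nil => rfl
  | cons x v ih =>
    simp only [genFun, genInv, Equiv.swap_apply_self, List.cons.injEq, true_and]
    by_cases h2 : x = i + 1
    · subst h2; simp [ih]
    · by_cases h1 : x = i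
      · subst h1
        have h3 : x + 1 ≠ x := fun h => h2 h.symm
        simp [ih, h2, h3]
      · rw [Equiv.swap_apply_of_ne_of_ne h1 h2]; simp [h1, h2]

theorem genFun_append {d : ℕ} (v : List (ZMod d)) (i x : ZMod d) :
    ∃ y, genFun i (v ++ [x]) = genFun i v ++ [y] := by
  induction v generalizing i with
  | nil => exact ⟨_, by simp [genFun]; rfl⟩
  | cons z v ih =>
    simp only [List.cons_append, genFun]
    split_ifs
    · obtain ⟨y, hy⟩ := ih i
      exact ⟨y, by rw [hy]⟩
    · obtain ⟨y, hy⟩ := ih (i + 1)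
      exact ⟨y, by rw [hy]⟩
    · exact ⟨x, rfl⟩

theorem genInv_append {d : ℕ} (v : List (ZMod d)) (i x : ZMod d) :
    ∃ y, genInv i (v ++ [x]) = genInv i v ++ [y] := by
  induction v generalizing i with
  | nil => exact ⟨_, by simp [genInv]; rfl⟩
  | cons z v ih =>
    simp only [List.cons_append, genInv]
    split_ifs
    · obtain ⟨y, hy⟩ := ih i
      exact ⟨y, by rw [hy]⟩
    · obtain ⟨y, hy⟩ := ih (i + 1)
      exact ⟨y, by rw [hy]⟩
    · exact ⟨x, rfl⟩

/-- `genFun i` as an automorphism of the tree. -/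
def genIso {d : ℕ} (i : ZMod d) : regularTree d ≃g regularTree d where
  toFun := genFun i
  invFun := genInv i
  left_inv v := genInv_genFun v i
  right_inv v := genFun_genInv v i
  map_rel_iff' := by
    intro u v
    change ((∃ x, genFun i v = genFun i u ++ [x]) ∨ (∃ x, genFun i u = genFun i v ++ [x])) ↔
      ((∃ x, v = u ++ [x]) ∨ (∃ x, u = v ++ [x]))
    have key : ∀ u v : List (ZMod d),
        (∃ x, genFun i v = genFun i u ++ [x]) ↔ ∃ x, v = u ++ [x] := by
      intro u v
      constructor
      · rintro ⟨x, hx⟩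
        obtain ⟨y, hy⟩ := genInv_append (genFun i u) i x
        exact ⟨y, by rw [← hx, genInv_genFun, genInv_genFun] at hy; exact hy⟩
      · rintro ⟨x, rfl⟩
        exact genFun_append u i x
    exact or_congr (key u v) (key v u)

/-- The automorphism `a i ∈ Aut(T)`, for `i` modulo `d`. -/
def treeGen {d : ℕ} (i : ZMod d) : AutTree d :=
  MulOpposite.op ⟨genIso i, rfl⟩

/-- The group `G_d`, generated by `a 1, …, a d`. -/
def treeGroup (d : ℕ) : Subgroup (AutTree d) :=
  Subgroup.closure (Set.range (treeGen (d := d)))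

/-- The generator `a i` as an element of `G_d`. -/
def groupGen {d : ℕ} (i : ZMod d) : treeGroup d :=
  ⟨treeGen i, Subgroup.subset_closure (Set.mem_range_self i)⟩

/-- The wreath recursion of the generators. -/
theorem treeGen_act_cons {d : ℕ} (i x : ZMod d) (v : List (ZMod d)) :
    (treeGen i).act (x :: v) = Equiv.swap i (i + 1) x ::
      (if x = i then (treeGen i).act v
        else if x = i + 1 then (treeGen (i + 1)).act v else v) := rfl

/-! ### Positive words, their action and their sections -/

/-- The action on the tree of the positive word `u` in the generators, read from left to right. -/
def wordAct {d : ℕ} (u : List (ZMod d)) (w : List (ZMod d)) : List (ZMod d) :=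
  u.foldl (fun w i => genFun i w) w

/-- The final position of the letter `x` under the positive word `u`. -/
def finalPos {d : ℕ} : List (ZMod d) → ZMod d → ZMod d
  | [], x => x
  | i :: u, x => finalPos u (Equiv.swap i (i + 1) x)

/-- The section of the positive word `u` at the letter `x`. It lists the positions from which
`x` is moved while `u` is applied. -/
def wordSection {d : ℕ} : List (ZMod d) → ZMod d → List (ZMod d)
  | [], _ => []
  | i :: u, x =>
      if x = i ∨ x = i + 1 then x :: wordSection u (Equiv.swap i (i + 1) x)
      else wordSection u x

/-- The successive positions of the letter `x` under the positive word `u`. -/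
def walk {d : ℕ} (u : List (ZMod d)) (x : ZMod d) : List (ZMod d) :=
  wordSection u x ++ [finalPos u x]

/-- Two letters at cyclic distance at most one. -/
def Near {d : ℕ} (i j : ZMod d) : Prop := j = i ∨ j = i + 1 ∨ i = j + 1

theorem wordAct_cons_letter {d : ℕ} (u : List (ZMod d)) (x : ZMod d) (w : List (ZMod d)) :
    wordAct u (x :: w) = finalPos u x :: wordAct (wordSection u x) w := by
  induction u generalizing x w with
  | nil => rfl
  | cons i u ih =>
    have h0 : wordAct (i :: u) (x :: w) = wordAct u (genFun i (x :: w)) := rfl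
    rw [h0, genFun, ih, finalPos, wordSection]
    by_cases h1 : x = i
    · subst h1; simp [wordAct]
    · by_cases h2 : x = i + 1
      · subst h2; simp [wordAct, h1]
      · rw [Equiv.swap_apply_of_ne_of_ne h1 h2]; simp [h1, h2]

theorem wordAct_cancel {d : ℕ} {i : ZMod d} {u v : List (ZMod d)}
    (h : wordAct (i :: u) = wordAct (i :: v)) : wordAct u = wordAct v := by
  funext w
  have h1 := congrFun h (genInv i w)
  have h0 : ∀ t, wordAct (i :: t) (genInv i w) = wordAct t w := fun t => by
    change wordAct t (genFun i (genInv i w)) = _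
    rw [genFun_genInv]
  rwa [h0, h0] at h1

theorem wordAct_section {d : ℕ} {u v : List (ZMod d)} (h : wordAct u = wordAct v) (x : ZMod d) :
    finalPos u x = finalPos v x ∧ wordAct (wordSection u x) = wordAct (wordSection v x) := by
  have h1 : ∀ w, finalPos u x = finalPos v x ∧
      wordAct (wordSection u x) w = wordAct (wordSection v x) w := fun w => by
    have h2 := congrFun h (x :: w)
    rw [wordAct_cons_letter, wordAct_cons_letter] at h2
    simpa using h2
  exact ⟨(h1 []).1, funext fun w => (h1 w).2⟩

theorem length_wordSection_le {d : ℕ} (u : List (ZMod d)) (x : ZMod d) :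
    (wordSection u x).length ≤ u.length := by
  induction u generalizing x with
  | nil => simp [wordSection]
  | cons i u ih =>
    rw [wordSection]
    split_ifs
    · simpa using ih _
    · exact (ih x).trans (by simp)

theorem wordSection_eq_nil_or {d : ℕ} (u : List (ZMod d)) (x : ZMod d) :
    wordSection u x = [] ∨ ∃ t, wordSection u x = x :: t := by
  induction u generalizing x with
  | nil => exact Or.inl rfl
  | cons i u ih =>
    rw [wordSection]
    split_ifs
    · exact Or.inr ⟨_, rfl⟩
    · exact ih x

theorem near_swap {d : ℕ} {i x : ZMod d} (h : x = i ∨ x = i + 1) :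
    Near x (Equiv.swap i (i + 1) x) := by
  rcases h with rfl | rfl <;> simp [Near]

theorem isChain_wordSection {d : ℕ} (u : List (ZMod d)) (x : ZMod d) :
    (wordSection u x).IsChain Near := by
  induction u generalizing x with
  | nil => exact List.IsChain.nil
  | cons i u ih =>
    rw [wordSection]
    split_ifs with h
    · have h1 := ih (Equiv.swap i (i + 1) x)
      rcases wordSection_eq_nil_or u (Equiv.swap i (i + 1) x) with h2 | ⟨t, h2⟩
      · rw [h2]; exact List.isChain_singleton _
      · rw [h2] at h1 ⊢
        exact List.isChain_cons_cons.2 ⟨near_swap h, h1⟩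
    · exact ih x

theorem walk_eq_cons {d : ℕ} (u : List (ZMod d)) (x : ZMod d) : ∃ t, walk u x = x :: t := by
  induction u generalizing x with
  | nil => exact ⟨[], rfl⟩
  | cons i u ih =>
    by_cases h : x = i ∨ x = i + 1
    · exact ⟨_, by rw [walk, wordSection, if_pos h]; rfl⟩
    · obtain ⟨t, ht⟩ := ih x
      push Not at h
      refine ⟨t, ?_⟩
      rw [← ht, walk, walk, wordSection, if_neg (by tauto), finalPos,
        Equiv.swap_apply_of_ne_of_ne h.1 h.2]

theorem walk_cons_of_mem {d : ℕ} {i x : ZMod d} (u : List (ZMod d)) (h : x = i ∨ x = i + 1) :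
    ∃ t, walk (i :: u) x = x :: Equiv.swap i (i + 1) x :: t := by
  obtain ⟨t, ht⟩ := walk_eq_cons u (Equiv.swap i (i + 1) x)
  exact ⟨t, by rw [← ht, walk, wordSection, if_pos h]; rfl⟩

theorem walk_cons_of_not_mem {d : ℕ} {i x : ZMod d} (u : List (ZMod d))
    (h : ¬(x = i ∨ x = i + 1)) : walk (i :: u) x = walk u x := by
  have h' := not_or.1 h
  rw [walk, walk, wordSection, if_neg h, finalPos, Equiv.swap_apply_of_ne_of_ne h'.1 h'.2]

section LargeDegree

variable {d : ℕ}

theorem zmod_one_ne_zero (hd : 3 ≤ d) : (1 : ZMod d) ≠ 0 := by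
  have : Fact (1 < d) := ⟨by omega⟩
  exact one_ne_zero

theorem zmod_two_ne_zero (hd : 3 ≤ d) : (1 + 1 : ZMod d) ≠ 0 := by
  intro h
  have h1 : ((2 : ℕ) : ZMod d) = 0 := by push_cast; rw [← h]; norm_num
  have := Nat.le_of_dvd (by norm_num) ((ZMod.natCast_eq_zero_iff 2 d).1 h1)
  omega

theorem self_ne_add_one (hd : 3 ≤ d) (i : ZMod d) : i ≠ i + 1 := fun h =>
  zmod_one_ne_zero hd (by simpa using h)

theorem self_ne_add_two (hd : 3 ≤ d) (i : ZMod d) : i ≠ i + 1 + 1 := fun h =>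
  zmod_two_ne_zero hd (by simpa [add_assoc] using h)

/-- A word that moves both `i` and `i + 1` at every step is a power of `i`. -/
theorem eq_of_length_wordSection (hd : 3 ≤ d) (i : ZMod d) (u : List (ZMod d))
    (h1 : (wordSection u i).length = u.length)
    (h2 : (wordSection u (i + 1)).length = u.length) : ∀ j ∈ u, j = i := by
  induction u with
  | nil => simp
  | cons j u ih =>
    have key : ∀ x, (wordSection (j :: u) x).length = (j :: u).length →
        (x = j ∨ x = j + 1) ∧
          (wordSection u (Equiv.swap j (j + 1) x)).length = u.length := by
      intro x hx
      rw [wordSection] at hx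
      split_ifs at hx with h
      · exact ⟨h, by simpa using hx⟩
      · have := length_wordSection_le u x
        simp only [List.length_cons] at hx
        omega
    obtain ⟨k1, l1⟩ := key i h1
    obtain ⟨k2, l2⟩ := key (i + 1) h2
    have hij : j = i := by
      rcases k1 with h | h
      · exact h.symm
      · rcases k2 with h' | h'
        · exact absurd (by rw [h', h] : i = i + 1 + 1) (self_ne_add_two hd i)
        · exact (add_right_cancel h').symm
    subst hij
    rw [Equiv.swap_apply_left] at l1
    rw [Equiv.swap_apply_right] at l2
    intro k hk
    rcases List.mem_cons.1 hk with rfl | hk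
    · rfl
    · exact ih l2 l1 k hk

/-- No nonempty positive word acts trivially. -/
theorem eq_nil_of_wordAct_eq (hd : 3 ≤ d) (u : List (ZMod d)) (h : wordAct u = wordAct []) :
    u = [] := by
  induction hn : u.length using Nat.strong_induction_on generalizing u with
  | _ n ih =>
    subst hn
    by_contra hu
    have full : ∀ w : List (ZMod d), w.length = u.length → wordAct w = wordAct [] →
        ∀ x, wordSection w x ≠ [] → (wordSection w x).length = w.length := by
      intro w hw hw0 x hx
      by_contra hne
      have hle := length_wordSection_le w x
      exact hx (ih _ (by omega) _ (wordAct_section hw0 x).2 rfl)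
    have const : ∀ (i : ZMod d) (w : List (ZMod d)), (i :: w).length = u.length →
        wordAct (i :: w) = wordAct [] → ∀ j ∈ i :: w, j = i := by
      intro i w hw hw0
      refine eq_of_length_wordSection hd i _ ?_ ?_
      · exact full _ hw hw0 _ (by simp [wordSection])
      · exact full _ hw hw0 _ (by simp [wordSection])
    obtain ⟨i, w, rfl⟩ := List.exists_cons_of_ne_nil hu
    have hall := const i w rfl h
    cases w with
    | nil =>
      have := (wordAct_section h i).1
      simp only [finalPos, Equiv.swap_apply_left] at this
      exact self_ne_add_one hd i this.symm
    | cons j w =>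
      have hj : j = i := hall j (by simp)
      subst hj
      have hs : wordSection (j :: j :: w) j = j :: (j + 1) :: wordSection w j := by
        simp [wordSection]
      have h1 := full _ rfl h j (by rw [hs]; simp)
      have h2 := (wordAct_section h j).2
      rw [hs] at h1 h2
      exact self_ne_add_one hd j (const j _ h1 h2 (j + 1) (by simp)).symm

/-- In a word with near consecutive letters, the first letter is `i` as soon as `i` and `i + 1`
first move to each other's position. -/
theorem head_eq_of_walk (hd : 3 ≤ d) (i : ZMod d) (v : List (ZMod d)) (hv : v.IsChain Near)
    (h1 : ∃ t, walk v i = i :: (i + 1) :: t) (h2 : ∃ t, walk v (i + 1) = (i + 1) :: i :: t) :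
    ∃ t, v = i :: t := by
  induction v with
  | nil =>
    obtain ⟨t, ht⟩ := h1
    simp [walk, wordSection] at ht
  | cons j v ih =>
    by_cases hji : j = i
    · exact ⟨v, by rw [hji]⟩
    by_cases hj2 : j = i + 1
    · subst hj2
      obtain ⟨t, ht⟩ := walk_cons_of_mem (i := i + 1) v (Or.inl rfl)
      obtain ⟨s, hs⟩ := h2
      rw [ht, Equiv.swap_apply_left] at hs
      simp only [List.cons.injEq] at hs
      exact absurd hs.2.1.symm (self_ne_add_two hd i)
    by_cases hj3 : i = j + 1
    · subst hj3
      obtain ⟨t, ht⟩ := walk_cons_of_mem (i := j) v (Or.inr rfl)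
      obtain ⟨s, hs⟩ := h1
      rw [ht, Equiv.swap_apply_right] at hs
      simp only [List.cons.injEq] at hs
      exact absurd hs.2.1 (self_ne_add_two hd j)
    have e1 : ¬(i = j ∨ i = j + 1) := by
      rintro (h | h)
      exacts [hji h.symm, hj3 h]
    have e2 : ¬(i + 1 = j ∨ i + 1 = j + 1) := by
      rintro (h | h)
      exacts [hj2 h.symm, hji (add_right_cancel h).symm]
    rw [walk_cons_of_not_mem v e1] at h1
    rw [walk_cons_of_not_mem v e2] at h2
    obtain ⟨t, rfl⟩ := ih hv.tail h1 h2
    rcases (List.isChain_cons_cons.1 hv).1 with h | h | h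
    exacts [absurd h.symm hji, absurd h hj3, absurd h hj2]

/-- A positive word with near consecutive letters is determined by its action. -/
theorem eq_of_wordAct_eq (hd : 3 ≤ d) (u v : List (ZMod d)) (hu : u.IsChain Near)
    (hv : v.IsChain Near) (h : wordAct u = wordAct v) : u = v := by
  induction hn : u.length + v.length using Nat.strong_induction_on generalizing u v with
  | _ n ih =>
    subst hn
    rcases u with _ | ⟨i, u⟩
    · exact (eq_nil_of_wordAct_eq hd v h.symm).symm
    rcases v with _ | ⟨j, v⟩
    · exact eq_nil_of_wordAct_eq hd _ h
    have hwalk : ∀ x, walk (i :: u) x = walk (j :: v) x := by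
      intro x
      obtain ⟨h1, h2⟩ := wordAct_section h x
      have c1 := isChain_wordSection (i :: u) x
      have c2 := isChain_wordSection (j :: v) x
      have l1 := length_wordSection_le (i :: u) x
      have l2 := length_wordSection_le (j :: v) x
      rw [walk, walk, h1]
      congr 1
      rcases wordSection_eq_nil_or (i :: u) x with h3 | ⟨s, h3⟩
      · rw [h3] at h2 ⊢
        exact (eq_nil_of_wordAct_eq hd _ h2.symm).symm
      rcases wordSection_eq_nil_or (j :: v) x with h4 | ⟨t, h4⟩
      · rw [h4] at h2 ⊢
        exact eq_nil_of_wordAct_eq hd _ h2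
      rw [h3] at h2 c1 l1 ⊢
      rw [h4] at h2 c2 l2 ⊢
      simp only [List.length_cons] at l1 l2
      rw [ih (s.length + t.length) (by simp only [List.length_cons]; omega) s t c1.tail c2.tail
        (wordAct_cancel h2) rfl]
    obtain ⟨t, ht⟩ : ∃ t, j :: v = i :: t := by
      refine head_eq_of_walk hd i _ hv ?_ ?_
      · rw [← hwalk]
        simpa using walk_cons_of_mem (i := i) u (Or.inl rfl)
      · rw [← hwalk]
        simpa using walk_cons_of_mem (i := i) u (Or.inr rfl)
    obtain ⟨rfl, rfl⟩ := List.cons.inj ht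
    rw [ih (u.length + v.length) (by simp only [List.length_cons]; omega) u v hu.tail hv.tail
      (wordAct_cancel h) rfl]

theorem act_prod_treeGen (u w : List (ZMod d)) :
    ((u.map treeGen).prod : AutTree d).act w = wordAct u w := by
  induction u generalizing w with
  | nil => rfl
  | cons i u ih =>
    rw [List.map_cons, List.prod_cons, AutTree.mul_act, ih]
    rfl

/-- Distinct lists over `{1, 2}` have distinct products in the group. -/
theorem prod_groupGen_injective (hd : 3 ≤ d) :
    Function.Injective fun l : List (Fin 2) =>
      (l.map ![groupGen (1 : ZMod d), groupGen (2 : ZMod d)]).prod := by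
  have hf : ![groupGen (1 : ZMod d), groupGen (2 : ZMod d)] =
      fun k : Fin 2 => groupGen ((![1, 2] : Fin 2 → ZMod d) k) := by
    funext k; fin_cases k <;> rfl
  have h12 : (1 + 1 : ZMod d) = 2 := one_add_one_eq_two
  have hinj : Function.Injective (![1, 2] : Fin 2 → ZMod d) := by
    have h := self_ne_add_one hd 1
    rw [h12] at h
    intro a b hab
    fin_cases a <;> fin_cases b <;> simp_all
  have hnear : ∀ a b : Fin 2, Near ((![1, 2] : Fin 2 → ZMod d) a) (![1, 2] b) := by
    intro a b
    fin_cases a <;> fin_cases b <;> simp [Near, h12]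
  have hchain : ∀ l : List (Fin 2), (l.map (![1, 2] : Fin 2 → ZMod d)).IsChain Near := by
    intro l
    rw [List.isChain_map]
    exact (List.pairwise_of_forall hnear).isChain
  have hval : ∀ l : List (Fin 2),
      (((l.map ![groupGen (1 : ZMod d), groupGen (2 : ZMod d)]).prod : treeGroup d) : AutTree d) =
        ((l.map (![1, 2] : Fin 2 → ZMod d)).map treeGen).prod := by
    intro l
    rw [hf, ← Subgroup.coe_subtype, map_list_prod, List.map_map, List.map_map]
    rfl
  intro l m hlm
  refine (List.map_injective_iff.2 hinj) (eq_of_wordAct_eq hd _ _ (hchain l) (hchain m) ?_)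
  funext w
  have h := congrArg (fun g : treeGroup d => (g : AutTree d).act w) hlm
  simp only [hval, act_prod_treeGen] at h
  exact h

end LargeDegree

/-! ### Free subsemigroups and exponential growth -/

/-- A family freely generates a subsemigroup when distinct lists have distinct products. -/
theorem freelyGeneratesSubsemigroup_of_injective {M ι : Type*} [Monoid M] (f : ι → M)
    (hf : Function.Injective fun l : List ι => (l.map f).prod) :
    FreelyGeneratesSubsemigroup f := by
  have hval : ∀ w : FreeSemigroup ι,
      ((FreeSemigroup.lift (fun i : ι =>
        (⟨f i, Subsemigroup.subset_closure (Set.mem_range_self i)⟩ :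
          Subsemigroup.closure (Set.range f))) w : Subsemigroup.closure (Set.range f)) : M) =
        ((w.head :: w.tail).map f).prod := by
    intro w
    induction w using FreeSemigroup.recOnMul with
    | ih1 x => simp
    | ih2 x y hx hy => simp_all
  constructor
  · intro w z h
    have h1 := congrArg Subtype.val h
    rw [hval, hval] at h1
    have h2 := hf h1
    obtain ⟨h3, h4⟩ := List.cons.inj h2
    exact FreeSemigroup.ext h3 h4
  · rintro ⟨g, hg⟩
    induction hg using Subsemigroup.closure_induction with
    | mem x hx =>
      obtain ⟨i, rfl⟩ := hx
      exact ⟨FreeSemigroup.of i, by simp⟩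
    | mul x y hx hy ihx ihy =>
      obtain ⟨a, ha⟩ := ihx
      obtain ⟨b, hb⟩ := ihy
      exact ⟨a * b, by rw [map_mul, ha, hb]; rfl⟩

section Growth

variable {G : Type*} [Group G]

theorem wordBall_finite {S : Set G} (hS : S.Finite) (n : ℕ) : (wordBall S n).Finite := by
  have hT : (S ∪ S⁻¹).Finite := hS.union hS.inv
  have : Finite ↥(S ∪ S⁻¹) := hT
  refine ((List.finite_length_le ↥(S ∪ S⁻¹) n).image
    fun l => (l.map Subtype.val).prod).subset ?_
  rintro g ⟨w, hw, hmem, rfl⟩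
  lift w to List ↥(S ∪ S⁻¹) using hmem
  exact ⟨w, by simpa using hw, rfl⟩

theorem wordBall_mono (S : Set G) {m n : ℕ} (h : m ≤ n) : wordBall S m ⊆ wordBall S n := by
  rintro g ⟨w, hw, hmem, hg⟩
  exact ⟨w, hw.trans h, hmem, hg⟩

theorem one_mem_wordBall (S : Set G) (n : ℕ) : 1 ∈ wordBall S n := ⟨[], by simp⟩

theorem mul_mem_wordBall {S : Set G} {m n : ℕ} {g h : G} (hg : g ∈ wordBall S m)
    (hh : h ∈ wordBall S n) : g * h ∈ wordBall S (m + n) := by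
  obtain ⟨w, hw, hmem, rfl⟩ := hg
  obtain ⟨z, hz, hmem', rfl⟩ := hh
  refine ⟨w ++ z, by simp; omega, fun s hs => ?_, by simp⟩
  rcases List.mem_append.1 hs with hs | hs
  exacts [hmem s hs, hmem' s hs]

theorem list_prod_mem_wordBall {S : Set G} {L : ℕ} (l : List G) (h : ∀ g ∈ l, g ∈ wordBall S L) :
    l.prod ∈ wordBall S (L * l.length) := by
  induction l with
  | nil => exact one_mem_wordBall S _
  | cons g l ih =>
    rw [List.prod_cons, List.length_cons, Nat.mul_succ, add_comm]
    exact mul_mem_wordBall (h g (by simp)) (ih fun k hk => h k (by simp [hk]))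

theorem exists_mem_wordBall {S : Set G} (hS : Subgroup.closure S = ⊤) (g : G) :
    ∃ n, g ∈ wordBall S n := by
  have hg : g ∈ Submonoid.closure (S ∪ S⁻¹) := by
    rw [← Subgroup.closure_toSubmonoid, hS]
    trivial
  obtain ⟨l, hl, hg⟩ := Submonoid.exists_list_of_mem_closure hg
  exact ⟨l.length, l, le_rfl, hl, hg⟩

/-- A finitely generated group containing a free subsemigroup of rank two has exponential
growth. -/
theorem hasExponentialGrowth_of_injective (hG : Group.FG G) (f : Fin 2 → G)
    (hf : Function.Injective fun l : List (Fin 2) => (l.map f).prod) :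
    HasExponentialGrowth G := by
  refine ⟨hG, fun S hS hgen => ?_⟩
  obtain ⟨L, hL0, hL⟩ : ∃ L, 0 < L ∧ ∀ k, f k ∈ wordBall S L := by
    choose N hN using fun k => exists_mem_wordBall hgen (f k)
    refine ⟨N 0 + N 1 + 1, by omega, fun k => wordBall_mono S ?_ (hN k)⟩
    fin_cases k <;> simp <;> omega
  have hpow : ∀ k, 2 ^ k ≤ growthFunction S (L * k) := by
    intro k
    have hinj : Function.Injective fun s : Fin k → Fin 2 => ((List.ofFn s).map f).prod :=
      fun s t h => List.ofFn_injective (hf h)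
    have hsub : Set.range (fun s : Fin k → Fin 2 => ((List.ofFn s).map f).prod) ⊆
        wordBall S (L * k) := by
      rintro _ ⟨s, rfl⟩
      have := list_prod_mem_wordBall (S := S) (L := L) ((List.ofFn s).map f) (by
        intro g hg
        obtain ⟨j, -, rfl⟩ := List.mem_map.1 hg
        exact hL j)
      simpa using this
    calc 2 ^ k = Nat.card (Fin k → Fin 2) := by simp
      _ = (Set.range fun s : Fin k → Fin 2 => ((List.ofFn s).map f).prod).ncard := by
        rw [← Set.image_univ, Set.ncard_image_of_injective _ hinj, Set.ncard_univ]
      _ ≤ _ := Set.ncard_le_ncard hsub (wordBall_finite hS _)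
  have hmono : ∀ {m n}, m ≤ n → growthFunction S m ≤ growthFunction S n := fun h =>
    Set.ncard_le_ncard (wordBall_mono S h) (wordBall_finite hS _)
  have htwo : 2 ≤ growthFunction S 1 := by
    obtain ⟨s, hs, hs1⟩ : ∃ s ∈ S, s ≠ 1 := by
      by_contra! hcon
      have hbot : Subgroup.closure S = ⊥ := (Subgroup.closure_eq_bot_iff).2 hcon
      have h1 : f 0 ∈ Subgroup.closure S := by rw [hgen]; trivial
      rw [hbot, Subgroup.mem_bot] at h1
      have h2 : [(0 : Fin 2)] = [] := hf (by simpa using h1)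
      simp at h2
    rw [← Set.ncard_pair hs1]
    refine Set.ncard_le_ncard ?_ (wordBall_finite hS _)
    rintro g (rfl | rfl)
    · exact ⟨[g], by simp [hs]⟩
    · exact one_mem_wordBall S 1
  have hc : (1 : ℝ) < 2 ^ ((1 : ℝ) / (2 * L : ℕ)) := by
    apply Real.one_lt_rpow (by norm_num)
    positivity
  refine ⟨_, hc, fun n => ?_⟩
  set c : ℝ := 2 ^ ((1 : ℝ) / (2 * L : ℕ)) with hcdef
  have hcL : c ^ (2 * L) = 2 := by
    rw [hcdef, ← Real.rpow_natCast, ← Real.rpow_mul (by norm_num), one_div_mul_cancel, Real.rpow_one]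
    positivity
  have hbound : ∀ k, n ≤ 2 * L * k → 2 ^ k ≤ growthFunction S n →
      c ^ n ≤ (growthFunction S n : ℝ) := by
    intro k hk hgr
    calc c ^ n ≤ c ^ (2 * L * k) := pow_le_pow_right₀ hc.le hk
      _ = 2 ^ k := by rw [pow_mul, hcL]
      _ ≤ _ := by exact_mod_cast hgr
  rcases Nat.eq_zero_or_pos n with rfl | hn
  · exact hbound 0 (by simp) (by simpa using hpow 0)
  rcases lt_or_ge n L with hnL | hnL
  · exact hbound 1 (by omega) (by simpa using htwo.trans (hmono hn))
  · refine hbound (n / L) ?_ ((hpow _).trans (hmono (Nat.mul_div_le n L)))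
    have h1 := Nat.div_add_mod n L
    have h2 := Nat.mod_lt n hL0
    have h3 : L * 1 ≤ L * (n / L) := Nat.mul_le_mul_left _ ((Nat.one_le_div_iff hL0).2 hnL)
    rw [mul_assoc]
    omega

end Growth

theorem treeGroup_fg (d : ℕ) [NeZero d] : Group.FG (treeGroup d) := by
  rw [Group.fg_iff_subgroup_fg]
  exact (Subgroup.fg_iff _).2 ⟨_, rfl, Set.finite_range _⟩

theorem mainTheorem7 (d : ℕ) (hd : 3 ≤ d) (hodd : Odd d) :
    FreelyGeneratesSubsemigroup ![groupGen (1 : ZMod d), groupGen (2 : ZMod d)] ∧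
      HasExponentialGrowth (treeGroup d) := by
  have : NeZero d := ⟨by omega⟩
  have h := prod_groupGen_injective hd
  exact ⟨freelyGeneratesSubsemigroup_of_injective _ h,
    hasExponentialGrowth_of_injective (treeGroup_fg d) _ h⟩
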